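/- Let $X$ be a compact Hausdorff space and let $A$ be a uniform algebra on $X$, that is, a subalgebra of the algebra $C(X)$ of continuous complex-valued functions on $X$ which contains the constants, separates the points of $X$ and is complete in the uniform norm. For $x\in X$ let $M_x=\{f\in A: f(x)=0\}$, let $J_x=\{f\in A: f^{-1}(\{0\})\text{ is a neighbourhood of }x\}$, and let $\overline{J_x}$ be the closure of $J_x$ in $A$. Set $$E=\{x\in X:\overline{J_x}\neq M_x\}.$$ Suppose that $E$ contains no non-empty perfect subset (a set is perfect if it is closed in $X$ and has no isolated points). Then: (a) the character space of $A$ is $X$, that is, the map $x\mapsto\varepsilon_x$, where $\varepsilon_x(f)=f(x)$, is a homeomorphism from $X$ onto the character space of $A$ (with the Gelfand topology); (b) $A$ is normal, that is, for every pair of disjoint closed subsets $S,T$ of the character space of $A$ there is an $f\in A$ with $\varphi(f)=0$ for all $\varphi\in S$ and $\varphi(f)=1$ for all $\varphi\in T$. -/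

import Mathlib

open Topology

namespace UniformAlg

variable {X : Type*} [TopologicalSpace X]

/-- A uniform algebra on the compact space `X`: a subalgebra of `C(X)` (so it contains the
constants) that separates the points of `X` and is complete in the uniform norm. -/
structure IsUniformAlgebra [CompactSpace X] (A : Subalgebra ℂ C(X, ℂ)) : Prop where
  separatesPoints : A.SeparatesPoints
  complete : IsComplete (A : Set C(X, ℂ))

/-- The ideal `M_x` of all `f ∈ A` with `f x = 0`. -/
def idealM (A : Subalgebra ℂ C(X, ℂ)) (x : X) : Ideal A where
  carrier := {f | (f : C(X, ℂ)) x = 0}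
  zero_mem' := by simp
  add_mem' := by
    intro f g hf hg
    simp only [Set.mem_ofPred_eq] at hf hg ⊢
    simp [hf, hg]
  smul_mem' := by
    intro c f hf
    simp only [Set.mem_ofPred_eq] at hf ⊢
    simp [hf]

/-- The ideal `J_x` of all `f ∈ A` whose zero set is a neighbourhood of `x`. -/
def idealJ (A : Subalgebra ℂ C(X, ℂ)) (x : X) : Ideal A where
  carrier := {f | (f : C(X, ℂ)) ⁻¹' {0} ∈ 𝓝 x}
  zero_mem' := Filter.Eventually.of_forall fun _ => rfl
  add_mem' := by
    intro f g hf hg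
    filter_upwards [hf, hg] with y hy hz
    simp only [Set.mem_preimage, Set.mem_singleton_iff] at hy hz ⊢
    simp [hy, hz]
  smul_mem' := by
    intro c f hf
    filter_upwards [hf] with y hy
    simp only [Set.mem_preimage, Set.mem_singleton_iff] at hy ⊢
    simp [hy]

/-- The set of the points `x` at which the closure of `J_x` in `A` differs from `M_x`. -/
def exceptionalSet (A : Subalgebra ℂ C(X, ℂ)) : Set X :=
  {x | closure (idealJ A x : Set A) ≠ (idealM A x : Set A)}

/-- The evaluation character `f ↦ f x` of `A`. -/
noncomputable def evalChar (A : Subalgebra ℂ C(X, ℂ)) (x : X) :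
    WeakDual.characterSpace ℂ A :=
  ⟨StrongDual.toWeakDual ((ContinuousMap.evalCLM ℂ x).comp A.toSubmodule.subtypeL),
    fun h => one_ne_zero (α := ℂ) (DFunLike.congr_fun h (1 : A)),
    fun _ _ => rfl⟩

/-- Evaluation characters are point evaluations. -/
theorem evalChar_apply (A : Subalgebra ℂ C(X, ℂ)) (x : X) (f : A) :
    evalChar A x f = (f : C(X, ℂ)) x := rfl

/-- `A` is normal, that is, normal on its character space, where `A` acts through the Gelfand
transform `φ ↦ φ f`. -/
def IsNormal (A : Subalgebra ℂ C(X, ℂ)) : Prop :=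
  ∀ S T : Set (WeakDual.characterSpace ℂ A), IsClosed S → IsClosed T → Disjoint S T →
    ∃ f : A, (∀ φ ∈ S, φ f = 0) ∧ (∀ φ ∈ T, φ f = 1)

end UniformAlg

/-!
Say that a closed set `K ⊆ X` dominates a character `φ` if `|φ f| ≤ sup_K |f|` for all `f ∈ A`.
If `K` dominates `φ` and `φ g ≠ 0`, then, by applying the inequality to `f ^ n * g`, the part of
`K` where `g` is nonzero already dominates `φ` (`Dominates.of_mul`). By Zorn's lemma `K` contains a
minimal closed dominating set `K₀`, and by minimality an element of `A` that vanishes on a nonempty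
open part of `K₀` is killed by `φ`. Suppose that `φ` is not the evaluation at a point of `K`. Then
every point `x` of `K₀` is exceptional: otherwise `J_x` would be dense in `M_x`, and `φ`, which
does not vanish on `M_x`, would not vanish on `J_x`. Since `K₀` is closed and nonempty, it has an
isolated point `x`; now all `f ∈ M_x` vanish on an open part of `K₀`, so `φ` is evaluation at
`x` after all. This gives `Dominates.exists_eq_evalChar`: a character dominated by a closed set `K`
is the evaluation at a point of `K`. With `K = X` this is (a), and for general `K` it says
that a point outside `K` can be separated from `K` in modulus (`exists_eq_one_norm_lt`).

For (b), fix `y` and let `R` be the closed set of the `x` with `J_x ⊆ M_y`. All points of `R` other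
than `y` are exceptional, so if there are any, then one of them, `x`, is isolated in `R`.
There is an `e ∈ A` close to `0` at `x` and close to `1` on `R \ {x}`, and, by compactness, a
`g ∈ A` with `g y = 1` that vanishes where `e` is close neither to `0` nor to `1`. Iterating the
polynomial `3 z² - 2 z³`, which attracts to `0` near `0` and to `1` near `1`, on `e`, and
multiplying by `g`, gives in the limit an element of `J_x` with value `1` at `y`, a contradiction. So
`R = {y}`, which by compactness means that `A` is regular on `X`. In view of (a), no character
kills both the functions vanishing on `S` and those vanishing on `T`, so these two ideals
sum to `A`, which is normality.
-/

namespace UniformAlg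

open WeakDual

/-! ### Dominating sets of a character -/

section Dominates

variable {X : Type*} [TopologicalSpace X] {A : Subalgebra ℂ C(X, ℂ)}

/-- `K` dominates the character `φ` if `|φ f| ≤ sup_K |f|` for all `f ∈ A`. The supremum is
replaced by arbitrary upper bounds `c ≥ 0`, so that no empty set, on which the
supremum has a junk value, can dominate `φ`. -/
def Dominates (φ : characterSpace ℂ A) (K : Set X) : Prop :=
  ∀ (f : A) (c : ℝ), 0 ≤ c → (∀ x ∈ K, ‖(f : C(X, ℂ)) x‖ ≤ c) → ‖φ f‖ ≤ c

theorem Dominates.nonempty {φ : characterSpace ℂ A} {K : Set X} (h : Dominates φ K) :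
    K.Nonempty := by
  by_contra hK
  have := h 1 0 le_rfl fun x hx => (hK ⟨x, hx⟩).elim
  rw [map_one] at this
  norm_num at this

/-- A bound up to a constant factor improves to a bound without it, by passing to powers. -/
theorem Dominates.of_le_mul {φ : characterSpace ℂ A} {K : Set X} (C : ℝ)
    (h : ∀ (f : A) (c : ℝ), 0 ≤ c → (∀ x ∈ K, ‖(f : C(X, ℂ)) x‖ ≤ c) → ‖φ f‖ ≤ C * c) :
    Dominates φ K := by
  intro f c hc hf
  have key : ∀ n : ℕ, ‖φ f‖ ^ n ≤ C * c ^ n := fun n => by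
    rw [← norm_pow, ← map_pow]
    refine h (f ^ n) (c ^ n) (pow_nonneg hc n) fun x hx => ?_
    have : ((f ^ n : A) : C(X, ℂ)) x = ((f : C(X, ℂ)) x) ^ n := by simp
    rw [this, norm_pow]
    exact pow_le_pow_left₀ (norm_nonneg _) (hf x hx) n
  by_contra! hlt
  rcases hc.eq_or_lt with rfl | hc
  · have := key 1
    simp only [pow_one, mul_zero] at this
    linarith
  · obtain ⟨n, hn⟩ := pow_unbounded_of_one_lt C ((one_lt_div hc).2 hlt)
    rw [div_pow, lt_div_iff₀ (pow_pos hc n)] at hn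
    exact (key n).not_gt hn

theorem dominates_univ [CompactSpace X] (φ : characterSpace ℂ A) :
    Dominates φ (Set.univ : Set X) := by
  refine Dominates.of_le_mul ‖toStrongDual (φ : WeakDual ℂ A)‖ fun f c hc hf => ?_
  refine ((toStrongDual (φ : WeakDual ℂ A)).le_opNorm f).trans ?_
  gcongr
  exact (ContinuousMap.norm_le _ hc).2 fun x => hf x trivial

/-- If `φ g ≠ 0`, then the part of a dominating set where `g` vanishes can be discarded. -/
theorem Dominates.of_mul [CompactSpace X] {φ : characterSpace ℂ A} {K K' : Set X}
    (h : Dominates φ K) (g : A) (hg : φ g ≠ 0) (hK : ∀ x ∈ K, x ∉ K' → (g : C(X, ℂ)) x = 0) :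
    Dominates φ K' := by
  refine Dominates.of_le_mul (‖φ g‖⁻¹ * ‖g‖) fun f c hc hf => ?_
  have h1 : ‖φ (f * g)‖ ≤ c * ‖g‖ := by
    refine h _ _ (by positivity) fun x hx => ?_
    have : ((f * g : A) : C(X, ℂ)) x = (f : C(X, ℂ)) x * (g : C(X, ℂ)) x := rfl
    rw [this, norm_mul]
    by_cases hx' : x ∈ K'
    · exact mul_le_mul (hf x hx') ((g : C(X, ℂ)).norm_coe_le_norm x) (norm_nonneg _) hc
    · rw [hK x hx hx', norm_zero, mul_zero]
      positivity
  rw [map_mul, norm_mul] at h1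
  have hpos : 0 < ‖φ g‖ := norm_pos_iff.2 hg
  rw [mul_assoc, inv_mul_eq_div, le_div_iff₀ hpos, mul_comm ‖g‖]
  exact h1

theorem Dominates.exists_minimal [CompactSpace X] {φ : characterSpace ℂ A} {K : Set X}
    (h : Dominates φ K) (hK : IsClosed K) :
    ∃ K₀ ⊆ K, Minimal (fun L => IsClosed L ∧ Dominates φ L) K₀ := by
  refine zorn_superset_nonempty {L | IsClosed L ∧ Dominates φ L} ?_ K ⟨hK, h⟩
  intro 𝒞 h𝒞 hchain hne
  refine ⟨⋂₀ 𝒞, ⟨isClosed_sInter fun L hL => (h𝒞 hL).1, fun f c hc hf => ?_⟩,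
    fun L hL => Set.sInter_subset_of_mem hL⟩
  refine le_of_forall_pos_le_add fun ε hε => ?_
  have : Nonempty 𝒞 := hne.to_subtype
  -- By compactness, some member of the chain lies in the open set where `|f| < c + ε`.
  obtain ⟨L, hL⟩ := exists_subset_nhds_of_compactSpace (V := fun L : 𝒞 => (L : Set X))
    (U := {x | ‖(f : C(X, ℂ)) x‖ < c + ε})
    (by
      intro L M
      rcases hchain.total L.2 M.2 with hLM | hML
      · exact ⟨L, le_rfl, hLM⟩
      · exact ⟨M, hML, le_rfl⟩) (fun L => (h𝒞 L.2).1) (fun x hx => by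
      rw [← Set.sInter_eq_iInter] at hx
      refine (isOpen_lt (by fun_prop) continuous_const).mem_nhds ?_
      have := hf x hx
      simp only [Set.mem_ofPred_eq]
      linarith)
  exact (h𝒞 L.2).2 f _ (by positivity) fun x hx => le_of_lt (hL hx)

theorem exists_apply_eq_zero_of_ne_evalChar {φ : characterSpace ℂ A} {x : X}
    (h : φ ≠ evalChar A x) : ∃ f : A, (f : C(X, ℂ)) x = 0 ∧ φ f ≠ 0 := by
  by_contra! H
  refine h (DFunLike.ext _ _ fun f => ?_)
  have := H (f + algebraMap ℂ A (-(f : C(X, ℂ)) x)) (by simp)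
  rw [map_add, AlgHomClass.commutes] at this
  exact add_neg_eq_zero.1 this

/-- A character that is not the evaluation at the nonexceptional point `x` does not vanish
on `J_x`. -/
theorem exists_mem_idealJ_of_ne_evalChar {φ : characterSpace ℂ A} {x : X}
    (h : φ ≠ evalChar A x) (hx : x ∉ exceptionalSet A) : ∃ g ∈ idealJ A x, φ g ≠ 0 := by
  obtain ⟨f, hf0, hf⟩ := exists_apply_eq_zero_of_ne_evalChar h
  by_contra! H
  have hx' : closure (idealJ A x : Set A) = (idealM A x : Set A) := not_not.1 hx
  have hfc : f ∈ closure (idealJ A x : Set A) := hx' ▸ hf0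
  exact hf (closure_minimal (t := {g : A | φ g = 0}) H
    (isClosed_eq (map_continuous φ) continuous_const) hfc)

/-- A character dominated by a closed set `K` is the evaluation at a point of `K`. -/
theorem Dominates.exists_eq_evalChar [CompactSpace X] {φ : characterSpace ℂ A} {K : Set X}
    (h : Dominates φ K) (hK : IsClosed K)
    (hE : ¬ ∃ P : Set X, P ⊆ exceptionalSet A ∧ P.Nonempty ∧ Perfect P) :
    ∃ x ∈ K, φ = evalChar A x := by
  by_contra! hφ
  obtain ⟨K₀, hK₀, hmin⟩ := h.exists_minimal hK
  have hcl : IsClosed K₀ := hmin.prop.1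
  have key : ∀ x ∈ K₀, ∀ U : Set X, IsOpen U → x ∈ U → ∀ g : A,
      (∀ z ∈ K₀, z ∈ U → (g : C(X, ℂ)) z = 0) → φ g = 0 := by
    intro x hx U hU hxU g hg
    by_contra hne
    have hd : Dominates φ (K₀ \ U) := hmin.prop.2.of_mul g hne fun z hz hz' =>
      hg z hz (by_contra fun hzU => hz' ⟨hz, hzU⟩)
    exact (hmin.le_of_le ⟨hcl.sdiff hU, hd⟩ Set.sdiff_subset hx).2 hxU
  refine hE ⟨K₀, fun x hx => ?_, hmin.prop.2.nonempty, hcl, ?_⟩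
  · by_contra hxE
    obtain ⟨g, hgJ, hg⟩ := exists_mem_idealJ_of_ne_evalChar (hφ x (hK₀ hx)) hxE
    obtain ⟨U, hUg, hU, hxU⟩ := mem_nhds_iff.1 hgJ
    exact hg (key x hx U hU hxU g fun z _ hz => hUg hz)
  · rw [preperfect_iff_nhds]
    intro x hx N hN
    by_contra! H
    obtain ⟨f, hf0, hf⟩ := exists_apply_eq_zero_of_ne_evalChar (hφ x (hK₀ hx))
    obtain ⟨U, hUN, hU, hxU⟩ := mem_nhds_iff.1 hN
    exact hf (key x hx U hU hxU f fun z hz hzU => by rw [H z ⟨hUN hzU, hz⟩, hf0])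

/-! ### The character space -/

theorem continuous_evalChar : Continuous (evalChar A) := by
  refine Continuous.subtype_mk (WeakDual.continuous_of_continuous_eval fun f => ?_) _
  exact (f : C(X, ℂ)).continuous

theorem evalChar_injective (hA : A.SeparatesPoints) : Function.Injective (evalChar A) := by
  intro x y hxy
  by_contra hne
  obtain ⟨_, ⟨f, hf, rfl⟩, hfxy⟩ := hA hne
  exact hfxy (DFunLike.congr_fun hxy (⟨f, hf⟩ : A))

theorem isHomeomorph_evalChar [CompactSpace X] (hA : A.SeparatesPoints)
    (hE : ¬ ∃ P : Set X, P ⊆ exceptionalSet A ∧ P.Nonempty ∧ Perfect P) :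
    IsHomeomorph (evalChar A) := by
  refine isHomeomorph_iff_continuous_bijective.2
    ⟨continuous_evalChar, evalChar_injective hA, fun φ => ?_⟩
  obtain ⟨x, -, hx⟩ := (dominates_univ φ).exists_eq_evalChar isClosed_univ hE
  exact ⟨x, hx.symm⟩

/-- Points can be separated in modulus from closed sets. -/
theorem exists_eq_one_norm_lt [CompactSpace X] (hA : A.SeparatesPoints)
    (hE : ¬ ∃ P : Set X, P ⊆ exceptionalSet A ∧ P.Nonempty ∧ Perfect P)
    {K : Set X} (hK : IsClosed K) {x : X} (hx : x ∉ K) {ε : ℝ} (hε : 0 < ε) :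
    ∃ f : A, (f : C(X, ℂ)) x = 1 ∧ ∀ z ∈ K, ‖(f : C(X, ℂ)) z‖ < ε := by
  have hnd : ¬ Dominates (evalChar A x) K := fun h => by
    obtain ⟨z, hz, hxz⟩ := h.exists_eq_evalChar hK hE
    exact hx (evalChar_injective hA hxz ▸ hz)
  by_contra! H
  refine hnd (Dominates.of_le_mul ε⁻¹ fun f c hc hf => ?_)
  rw [evalChar_apply]
  rcases eq_or_ne ((f : C(X, ℂ)) x) 0 with h0 | h0
  · rw [h0, norm_zero]
    positivity
  obtain ⟨z, hz, hεz⟩ := H (((f : C(X, ℂ)) x)⁻¹ • f) (by simp [h0])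
  have h1 : ε ≤ ‖(f : C(X, ℂ)) x‖⁻¹ * ‖(f : C(X, ℂ)) z‖ := by
    simpa [norm_mul] using hεz
  have hpos : 0 < ‖(f : C(X, ℂ)) x‖ := norm_pos_iff.2 h0
  rw [inv_mul_eq_div, le_div_iff₀ hpos] at h1
  rw [inv_mul_eq_div, le_div_iff₀ hε, mul_comm]
  exact h1.trans (hf z hz)

end Dominates

/-! ### The polynomial `3 a ^ 2 - 2 a ^ 3` -/

/-- The cubic `3 a ^ 2 - 2 a ^ 3`, with superattracting fixed points `0` and `1`. Its iterates turn
approximate idempotents into idempotents. -/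
def smoothStep {R : Type*} [CommRing R] (a : R) : R := 3 * a ^ 2 - 2 * a ^ 3

theorem norm_smoothStep_le {z : ℂ} (hz : ‖z‖ ≤ 1 / 4) : ‖smoothStep z‖ ≤ 7 / 8 * ‖z‖ := by
  have h1 : smoothStep z = z * (z * (3 - 2 * z)) := by
    unfold smoothStep
    ring
  have h2 : ‖3 - 2 * z‖ ≤ 7 / 2 := by
    refine (norm_sub_le _ _).trans ?_
    rw [norm_mul]
    norm_num
    linarith
  rw [h1, norm_mul, norm_mul, mul_comm]
  refine mul_le_mul_of_nonneg_right ?_ (norm_nonneg _)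
  nlinarith [norm_nonneg z, norm_nonneg (3 - 2 * z)]

theorem norm_iterate_smoothStep_le {z : ℂ} (hz : ‖z‖ ≤ 1 / 4) (n : ℕ) :
    ‖smoothStep^[n] z‖ ≤ (7 / 8) ^ n * (1 / 4) := by
  induction n with
  | zero => simpa using hz
  | succ n ih =>
    have h1 : ((7 : ℝ) / 8) ^ n ≤ 1 := pow_le_one₀ (by norm_num) (by norm_num)
    rw [Function.iterate_succ_apply', pow_succ]
    have := norm_smoothStep_le (ih.trans (by linarith))
    linarith

theorem norm_iterate_smoothStep_sub_one_le {z : ℂ} (hz : ‖z - 1‖ ≤ 1 / 4) (n : ℕ) :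
    ‖smoothStep^[n] z - 1‖ ≤ (7 / 8) ^ n * (1 / 4) := by
  have hsymm : Function.Semiconj (fun w : ℂ => 1 - w) smoothStep smoothStep := fun w => by
    unfold smoothStep
    ring
  have h1 := hsymm.iterate_right n z
  rw [norm_sub_rev, h1]
  exact norm_iterate_smoothStep_le (by rwa [norm_sub_rev]) n

section Normal

variable {X : Type*} [TopologicalSpace X] {A : Subalgebra ℂ C(X, ℂ)}

theorem iterate_smoothStep_apply (e : A) (n : ℕ) (z : X) :
    ((smoothStep^[n] e : A) : C(X, ℂ)) z = smoothStep^[n] ((e : C(X, ℂ)) z) := by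
  have : Function.Semiconj (fun a : A => (a : C(X, ℂ)) z) smoothStep smoothStep := fun a => by
    have h2 : ((2 : A) : C(X, ℂ)) z = 2 := rfl
    have h3 : ((3 : A) : C(X, ℂ)) z = 3 := rfl
    simp only [smoothStep, AddSubgroupClass.coe_sub, MulMemClass.coe_mul, SubmonoidClass.coe_pow,
      ContinuousMap.sub_apply, ContinuousMap.mul_apply, ContinuousMap.pow_apply, h2, h3]
  exact this.iterate_right n e

/-- If `g` vanishes wherever `e` is close neither to `0` nor to `1`, then some `h ∈ A` vanishes
where `e` is close to `0` and agrees with `g` where `e` is close to `1`. -/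
theorem exists_eq_zero_and_eq_of_approx_idempotent [CompactSpace X] [CompleteSpace A] (e g : A)
    (heg : ∀ z, ‖(e : C(X, ℂ)) z‖ ≤ 1 / 4 ∨ ‖(e : C(X, ℂ)) z - 1‖ ≤ 1 / 4 ∨
      (g : C(X, ℂ)) z = 0) :
    ∃ h : A, ∀ z, (‖(e : C(X, ℂ)) z‖ ≤ 1 / 4 → (h : C(X, ℂ)) z = 0) ∧
      (‖(e : C(X, ℂ)) z - 1‖ ≤ 1 / 4 → (h : C(X, ℂ)) z = (g : C(X, ℂ)) z) := by
  have happ : ∀ (n : ℕ) (z : X), ((g * smoothStep^[n] e : A) : C(X, ℂ)) z =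
      (g : C(X, ℂ)) z * smoothStep^[n] ((e : C(X, ℂ)) z) := fun n z => by
    rw [← iterate_smoothStep_apply]
    rfl
  have hstep : ∀ (w : ℂ) (n : ℕ), (‖w‖ ≤ 1 / 4 ∨ ‖w - 1‖ ≤ 1 / 4) →
      ‖smoothStep^[n] w - smoothStep^[n + 1] w‖ ≤ (7 / 8) ^ n := by
    intro w n hw
    have hp : (0 : ℝ) ≤ (7 / 8) ^ n := by positivity
    have hp' : ((7 : ℝ) / 8) ^ (n + 1) = (7 / 8) ^ n * (7 / 8) := pow_succ _ _
    rcases hw with hw | hw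
    · have h1 := norm_iterate_smoothStep_le hw n
      have h2 := norm_iterate_smoothStep_le hw (n + 1)
      refine (norm_sub_le _ _).trans ?_
      linarith
    · have h1 := norm_iterate_smoothStep_sub_one_le hw n
      have h2 := norm_iterate_smoothStep_sub_one_le hw (n + 1)
      have h3 := norm_sub_le (smoothStep^[n] w - 1) (smoothStep^[n + 1] w - 1)
      rw [sub_sub_sub_cancel_right] at h3
      linarith
  have hcauchy : CauchySeq fun n => g * smoothStep^[n] e := by
    refine cauchySeq_of_le_geometric (7 / 8) ‖g‖ (by norm_num) fun n => ?_
    rw [dist_eq_norm]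
    refine (ContinuousMap.norm_le _ (by positivity)).2 fun z => ?_
    have : ((g * smoothStep^[n] e - g * smoothStep^[n + 1] e : A) : C(X, ℂ)) z =
        (g : C(X, ℂ)) z *
          (smoothStep^[n] ((e : C(X, ℂ)) z) - smoothStep^[n + 1] ((e : C(X, ℂ)) z)) := by
      rw [mul_sub, ← happ, ← happ]
      rfl
    refine (congrArg norm this).trans_le ?_
    rw [norm_mul]
    have hgz : ‖(g : C(X, ℂ)) z‖ ≤ ‖g‖ := (g : C(X, ℂ)).norm_coe_le_norm z
    rcases or_assoc.2 (heg z) with hz | hz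
    · exact mul_le_mul hgz (hstep _ n hz) (norm_nonneg _) (norm_nonneg _)
    · rw [hz, norm_zero, zero_mul]
      positivity
  obtain ⟨h, hh⟩ := cauchySeq_tendsto_of_complete hcauchy
  have hpt : ∀ z, Filter.Tendsto
      (fun n => (g : C(X, ℂ)) z * smoothStep^[n] ((e : C(X, ℂ)) z)) Filter.atTop
      (𝓝 ((h : C(X, ℂ)) z)) := fun z => by
    have := ((map_continuous (evalChar A z)).tendsto h).comp hh
    exact this.congr fun n => happ n z
  have hgeo : Filter.Tendsto (fun n : ℕ => ((7 : ℝ) / 8) ^ n * (1 / 4)) Filter.atTop (𝓝 0) := by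
    have := (tendsto_pow_atTop_nhds_zero_of_lt_one (r := (7 : ℝ) / 8) (by norm_num)
      (by norm_num)).mul_const (1 / 4)
    rwa [zero_mul] at this
  refine ⟨h, fun z => ⟨fun hz => ?_, fun hz => ?_⟩⟩
  · have := (squeeze_zero_norm (norm_iterate_smoothStep_le hz) hgeo).const_mul ((g : C(X, ℂ)) z)
    rw [mul_zero] at this
    exact tendsto_nhds_unique (hpt z) this
  · have h1 := tendsto_sub_nhds_zero_iff.1
      (squeeze_zero_norm (norm_iterate_smoothStep_sub_one_le hz) hgeo)
    have := h1.const_mul ((g : C(X, ℂ)) z)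
    rw [mul_one] at this
    exact tendsto_nhds_unique (hpt z) this

/-! ### Regularity and normality -/

/-- If every `x ∈ K` has an element of `J_x` not vanishing at `y`, then by compactness a product
of finitely many of them vanishes on `K`. -/
theorem exists_eq_one_eqOn_zero [CompactSpace X] {K : Set X} (hK : IsClosed K) {y : X}
    (h : ∀ x ∈ K, ∃ g ∈ idealJ A x, (g : C(X, ℂ)) y ≠ 0) :
    ∃ g : A, (g : C(X, ℂ)) y = 1 ∧ ∀ x ∈ K, (g : C(X, ℂ)) x = 0 := by
  refine hK.isCompact.induction_on
    (p := fun s => ∃ g : A, (g : C(X, ℂ)) y = 1 ∧ ∀ x ∈ s, (g : C(X, ℂ)) x = 0)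
    ⟨1, rfl, by simp⟩ (fun s t hst ⟨g, hg1, hg⟩ => ⟨g, hg1, fun x hx => hg x (hst hx)⟩) ?_ ?_
  · rintro s t ⟨g, hg1, hg⟩ ⟨k, hk1, hk⟩
    refine ⟨g * k, by simp [hg1, hk1], ?_⟩
    rintro x (hx | hx)
    · simp [hg x hx]
    · simp [hk x hx]
  · intro x hx
    obtain ⟨g, hgJ, hg⟩ := h x hx
    refine ⟨_, mem_nhdsWithin_of_mem_nhds hgJ, ((g : C(X, ℂ)) y)⁻¹ • g, by simp [hg], ?_⟩
    intro z hz
    have hz' : (g : C(X, ℂ)) z = 0 := hz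
    simp [hz']

theorem isClosed_setOf_idealJ_le_idealM (y : X) :
    IsClosed {x : X | idealJ A x ≤ idealM A y} := by
  rw [← isOpen_compl_iff, isOpen_iff_mem_nhds]
  intro x hx
  obtain ⟨g, hgJ, hg⟩ := SetLike.not_le_iff_exists.1 (show ¬ idealJ A x ≤ idealM A y from hx)
  have hg0 : (g : C(X, ℂ)) ⁻¹' {0} ∈ 𝓝 x := hgJ
  filter_upwards [eventually_mem_nhds_iff.2 hg0] with z hz hle
  exact hg (hle hz)

/-- The ideals `J_x` determine their points: `J_x ⊆ M_y` only for `x = y`. -/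
theorem eq_of_idealJ_le_idealM [CompactSpace X] [T2Space X] (hA : IsUniformAlgebra A)
    (hE : ¬ ∃ P : Set X, P ⊆ exceptionalSet A ∧ P.Nonempty ∧ Perfect P) {x y : X}
    (hxy : idealJ A x ≤ idealM A y) : x = y := by
  by_contra hne
  have : CompleteSpace A := hA.complete.completeSpace_coe
  set R : Set X := {x | idealJ A x ≤ idealM A y} with hR
  have hRc : IsClosed R := isClosed_setOf_idealJ_le_idealM y
  have hRE : ∀ z ∈ R, z ≠ y → z ∈ exceptionalSet A := by
    intro z hz hzy
    by_contra hzE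
    obtain ⟨g, hgJ, hg⟩ := exists_mem_idealJ_of_ne_evalChar
      (fun h => hzy (evalChar_injective hA.separatesPoints h).symm) hzE (φ := evalChar A y)
    exact hg (hz hgJ)
  obtain ⟨U, hxU, hU, hyU⟩ : ∃ U : Set X, x ∈ U ∧ IsOpen U ∧ y ∉ closure U := by
    obtain ⟨U, V, hU, hV, hxU, hyV, hUV⟩ := t2_separation hne
    exact ⟨U, hxU, hU, fun hy => (hUV.closure_left hV).le_bot ⟨hy, hyV⟩⟩
  -- The closure of `U ∩ R` is contained in the exceptional set, hence has an isolated point `p`.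
  refine hE ⟨closure (U ∩ R), fun z hz => ?_, ⟨x, subset_closure ⟨hxU, hxy⟩⟩,
    isClosed_closure, preperfect_iff_nhds.2 fun p hp N hN => ?_⟩
  · refine hRE z (hRc.closure_subset_iff.2 Set.inter_subset_right hz) ?_
    rintro rfl
    exact hyU (closure_mono Set.inter_subset_left hz)
  by_contra! H
  have hpUR : p ∈ U ∩ R := by
    obtain ⟨q, hqN, hq⟩ := mem_closure_iff_nhds.1 hp N hN
    exact H q ⟨hqN, subset_closure hq⟩ ▸ hq
  have hpy : p ≠ y := fun h => hyU (h ▸ subset_closure hpUR.1)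
  obtain ⟨W, hWN, hW, hpW⟩ := mem_nhds_iff.1 hN
  -- As `p ∈ U`, it is isolated in `R` as well, so `R \ (W ∩ U) = R \ {p}`.
  have hiso : ∀ z ∈ R, z ∈ W ∩ U → z = p := fun z hz hzW =>
    H z ⟨hWN hzW.1, subset_closure ⟨hzW.2, hz⟩⟩
  obtain ⟨f, hfp, hf⟩ := exists_eq_one_norm_lt hA.separatesPoints hE
    (hRc.sdiff (hW.inter hU)) (fun h => h.2 ⟨hpW, hpUR.1⟩) (show (0 : ℝ) < 1 / 4 by norm_num)
  set e : A := 1 - f with he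
  have he' : ∀ z, (e : C(X, ℂ)) z = 1 - (f : C(X, ℂ)) z := fun z => rfl
  have hVo : IsOpen {z | ‖(e : C(X, ℂ)) z‖ < 1 / 4 ∨ ‖(e : C(X, ℂ)) z - 1‖ < 1 / 4} :=
    (isOpen_lt (e : C(X, ℂ)).continuous.norm continuous_const).union
      (isOpen_lt ((e : C(X, ℂ)).continuous.sub continuous_const).norm continuous_const)
  have hoff : ∀ z ∈ R \ (W ∩ U), ‖(e : C(X, ℂ)) z - 1‖ < 1 / 4 := fun z hz => by
    simpa [he'] using hf z hz
  have hep : ‖(e : C(X, ℂ)) p‖ < 1 / 4 := by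
    rw [he', hfp]
    norm_num
  obtain ⟨g, hgy, hg⟩ := exists_eq_one_eqOn_zero (A := A) (y := y) hVo.isClosed_compl
    (fun z hz => by
      refine (SetLike.not_le_iff_exists (p := idealJ A z) (q := idealM A y)).1 fun hzR => hz ?_
      by_cases hzW : z ∈ W ∩ U
      · exact Or.inl (hiso z hzR hzW ▸ hep)
      · exact Or.inr (hoff z ⟨hzR, hzW⟩))
  obtain ⟨h, hh⟩ := exists_eq_zero_and_eq_of_approx_idempotent e g fun z => by
    by_cases hz : ‖(e : C(X, ℂ)) z‖ < 1 / 4 ∨ ‖(e : C(X, ℂ)) z - 1‖ < 1 / 4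
    · exact hz.elim (fun h => Or.inl h.le) fun h => Or.inr (Or.inl h.le)
    · exact Or.inr (Or.inr (hg z hz))
  have hhJ : h ∈ idealJ A p := by
    filter_upwards [(e : C(X, ℂ)).continuous.norm.continuousAt.eventually_lt
      continuousAt_const hep] with z hz
    exact (hh z).1 (le_of_lt hz)
  have hhy : (h : C(X, ℂ)) y = 0 := hpUR.2 hhJ
  have hyR : y ∈ R := by
    intro k hk
    have hk0 : (k : C(X, ℂ)) ⁻¹' {0} ∈ 𝓝 y := hk
    exact (mem_of_mem_nhds hk0 : y ∈ (k : C(X, ℂ)) ⁻¹' {0})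
  rw [(hh y).2 (hoff y ⟨hyR, fun hy => hpy (hiso y hyR hy).symm⟩).le, hgy] at hhy
  exact one_ne_zero hhy

theorem isNormal [CompactSpace X] [T2Space X] (hA : IsUniformAlgebra A)
    (hE : ¬ ∃ P : Set X, P ⊆ exceptionalSet A ∧ P.Nonempty ∧ Perfect P) : IsNormal A := by
  intro S T hS hT hST
  have : CompleteSpace A := hA.complete.completeSpace_coe
  let I : Set (characterSpace ℂ A) → Ideal A := fun S => ⨅ φ ∈ S, RingHom.ker φ
  have hI : ∀ S f, f ∈ I S ↔ ∀ φ ∈ S, φ f = 0 := fun S f => by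
    simp [I, Submodule.mem_iInf, RingHom.mem_ker]
  have hreg : ∀ S : Set (characterSpace ℂ A), IsClosed S → ∀ ψ : characterSpace ℂ A, ψ ∉ S →
      ∃ f ∈ I S, ψ f ≠ 0 := by
    intro S hS ψ hψ
    have hsurj := (isHomeomorph_evalChar hA.separatesPoints hE).surjective
    obtain ⟨y, rfl⟩ := hsurj ψ
    obtain ⟨g, hgy, hg⟩ := exists_eq_one_eqOn_zero (A := A) (y := y)
      (hS.preimage continuous_evalChar) (fun x hx =>
        (SetLike.not_le_iff_exists (p := idealJ A x) (q := idealM A y)).1 fun hxy => by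
          obtain rfl := eq_of_idealJ_le_idealM hA hE hxy
          exact hψ hx)
    refine ⟨g, (hI S g).2 fun φ hφ => ?_, ?_⟩
    · obtain ⟨x, rfl⟩ := hsurj φ
      exact hg x hφ
    · rw [evalChar_apply, hgy]
      exact one_ne_zero
  have htop : I S ⊔ I T = ⊤ := by
    by_contra hne
    obtain ⟨M, hM, hle⟩ := Ideal.exists_le_maximal _ hne
    have hzero : ∀ f ∈ I S ⊔ I T, M.toCharacterSpace f = 0 := fun f hf =>
      M.toCharacterSpace_apply_eq_zero_of_mem (hle hf)
    by_cases hmem : M.toCharacterSpace ∈ S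
    · obtain ⟨f, hf, hf0⟩ := hreg T hT _ (Set.disjoint_left.1 hST hmem)
      exact hf0 (hzero f (le_sup_right (a := I S) hf))
    · obtain ⟨f, hf, hf0⟩ := hreg S hS _ hmem
      exact hf0 (hzero f (le_sup_left (b := I T) hf))
  obtain ⟨f, hf, g, hg, hfg⟩ := Submodule.mem_sup.1 ((Ideal.eq_top_iff_one _).1 htop)
  refine ⟨f, (hI S f).1 hf, fun φ hφ => ?_⟩
  have h1 : φ f + φ g = 1 := by rw [← map_add, hfg, map_one]
  rwa [(hI T g).1 hg φ hφ, add_zero] at h1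

end Normal

end UniformAlg

theorem theorem7 {X : Type*} [TopologicalSpace X] [CompactSpace X] [T2Space X]
    (A : Subalgebra ℂ C(X, ℂ)) (hA : UniformAlg.IsUniformAlgebra A)
    (hE : ¬ ∃ P : Set X, P ⊆ UniformAlg.exceptionalSet A ∧ P.Nonempty ∧ Perfect P) :
    IsHomeomorph (UniformAlg.evalChar A) ∧ UniformAlg.IsNormal A :=
  ⟨UniformAlg.isHomeomorph_evalChar hA.separatesPoints hE, UniformAlg.isNormal hA hE⟩
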